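/- Let $w=w_1w_2\cdots w_n$ be a word of length $n$ over the alphabet $\{1,2,\ldots,q\}$, and let $\mathtt{rev}(w)=w_nw_{n-1}\cdots w_1$. Young diagrams are drawn in English notation, and an increasing tableau is a filling of a Young diagram by positive integers that is strictly increasing along rows and down columns. Hecke insertion $T\leftarrow x$ of an integer $x$ into an increasing tableau $T$ is the following procedure. Begin by inserting $x$ into the first row of $T$. To insert an integer $x$ into a row $R$ (possibly the empty row just below the last row): if $x$ is larger than or equal to all entries of $R$, then adjoin $x$ to the end of $R$ if this results in an increasing tableau, leave the tableau unchanged otherwise, and stop in either case. If $R$ has entries strictly larger than $x$, let $y$ be the smallest of them; replace $y$ by $x$ if this results in an increasing tableau, and leave $R$ unchanged otherwise; in either case insert $y$ into the next row. Let $\mathtt{Heckeshape}(w)$ be the Young diagram that is the shape of the insertion tableau $P=(((\emptyset\leftarrow w_1)\leftarrow w_2)\leftarrow\cdots)\leftarrow w_n$. **Corollary 4.5.** Let $\lambda=\mathtt{Heckeshape}(w)$ and $\mu=\mathtt{Heckeshape}(\mathtt{rev}(w))$. Then $\lambda_1=\mu'_1$ and $\mu_1=\lambda'_1$, where $\lambda'$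 and $\mu'$ are the conjugate shapes of $\lambda$ and $\mu$, and $\nu_1$ denotes the length of the first row of $\nu$ ($0$ if $\nu$ is empty). That is, the length of the first row of each of the two shapes equals the length of the first column of the other. -/

import Mathlib

namespace PlancherelHecke

/-- `W n q`: the words of length `n` over the alphabet `{1, ..., q}`. -/
def W (n q : ℕ) : Set (List ℕ) :=
  {w | w.length = n ∧ ∀ a ∈ w, 1 ≤ a ∧ a ≤ q}

/-- A filling of a Young diagram, given as its list of rows from top to bottom (English notation),
is an increasing tableau: no listed row is empty, the row lengths weakly decrease, and the entries
strictly increase along every row and down every column. -/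
def IsIncreasing (T : List (List ℕ)) : Prop :=
  (∀ R ∈ T, R ≠ []) ∧
  (∀ R ∈ T, R.Pairwise (· < ·)) ∧
  T.Pairwise (fun R S => S.length ≤ R.length ∧ ∀ j < S.length, R.getD j 0 < S.getD j 0)

instance (T : List (List ℕ)) : Decidable (IsIncreasing T) := by
  unfold IsIncreasing
  infer_instance

/-- One insertion in progress: the rows `above` have been treated already, and `x` is to be
inserted into the first row of `below` (into a new empty row if `below = []`); the current tableau
is `above ++ below`.

* If `x` is larger than or equal to all entries of the row, the insertion terminates: `x` is
  adjoined to the end of the row if this gives an increasing tableau, and otherwise nothing changes.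
* Otherwise let `y` be the smallest entry of the row that is strictly larger than `x`. It is
  replaced by `x` if this gives an increasing tableau. In either case `y` is inserted into the next
  row. -/
def insertBelow : (above below : List (List ℕ)) → (x : ℕ) → List (List ℕ)
  | above, [], x =>
      if IsIncreasing (above ++ [[x]]) then above ++ [[x]] else above
  | above, R :: rest, x =>
      match (R.filter (fun z => x < z)).min? with
      | none =>
          if IsIncreasing (above ++ (R ++ [x]) :: rest) then above ++ (R ++ [x]) :: rest
          else above ++ R :: rest
      | some y =>
          if IsIncreasing (above ++ R.replace y x :: rest) then
            insertBelow (above ++ [R.replace y x]) rest y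
          else insertBelow (above ++ [R]) rest y

/-- Hecke insertion `T ← x`. -/
def heckeInsert (T : List (List ℕ)) (x : ℕ) : List (List ℕ) :=
  insertBelow [] T x

/-- The insertion tableau `P = ((∅ ← w₁) ← w₂) ← ⋯ ← wₙ` of the word `w`. -/
def insertionTableau (w : List ℕ) : List (List ℕ) :=
  w.foldl heckeInsert []

theorem isIncreasing_insertBelow (above below : List (List ℕ)) (x : ℕ)
    (h : IsIncreasing (above ++ below)) : IsIncreasing (insertBelow above below x) := by
  induction below generalizing above x with
  | nil =>
    rw [insertBelow]
    split_ifs with h1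
    · exact h1
    · simpa using h
  | cons R rest ih =>
    rw [insertBelow]
    split
    · split_ifs with h1
      · exact h1
      · exact h
    · split_ifs with h1
      · exact ih _ _ (by simpa using h1)
      · exact ih _ _ (by simpa using h)

theorem isIncreasing_insertionTableau (w : List ℕ) : IsIncreasing (insertionTableau w) := by
  induction w using List.reverseRecOn with
  | nil => simp [insertionTableau, IsIncreasing]
  | append_singleton w x ih =>
    rw [insertionTableau, List.foldl_append]
    exact isIncreasing_insertBelow [] _ x ih

theorem sortedGE_rowLengths (w : List ℕ) :
    ((insertionTableau w).map List.length).SortedGE := by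
  refine List.Pairwise.sortedGE ?_
  rw [List.pairwise_map]
  exact (isIncreasing_insertionTableau w).2.2.imp (fun h => h.1)

/-- `heckeshape w`: the Young diagram that is the shape of the insertion tableau of `w`. -/
def heckeshape (w : List ℕ) : YoungDiagram :=
  YoungDiagram.ofRowLens ((insertionTableau w).map List.length) (sortedGE_rowLengths w)

end PlancherelHecke

/-! For every word, the first row of the insertion tableau has the length of a longest strictly
increasing subsequence, and the first column that of a longest strictly decreasing one. Reversing
the word exchanges the two kinds of subsequence, which gives both equalities.

Rows (`isLongest_countP_firstRow`): the first row evolves on its own, as in patience sorting. Its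
number of entries below `m` is the longest increasing length among letters below `m`, for every `m`
at once.

Columns (`decEquiv_readingWord_insertionTableau`): inserting a letter changes the row reading word
only by local exchanges that preserve the lengths of decreasing subsequences. In the reading word of
an increasing tableau the longest such length is the number of rows. The delicate case is a letter
that cannot be placed: it is then in the row already or in the row above
(`mem_of_not_isIncreasing`), and can be absorbed (`decDom_absorb`). -/

namespace PlancherelHecke

/-! ### Comparison of words by their decreasing subsequences -/

/-- Every strictly decreasing subsequence of `u` can be traded for one of `v` of the same length
whose entries lie between entries of the original one. -/
def DecDom (u v : List ℕ) : Prop :=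
  ∀ s : List ℕ, s.Sublist u → s.Pairwise (· > ·) → ∃ t : List ℕ, t.Sublist v ∧ t.Pairwise (· > ·) ∧
    t.length = s.length ∧ ∀ i ∈ t, (∃ j ∈ s, i ≤ j) ∧ ∃ j ∈ s, j ≤ i

theorem DecDom.of_sublist {u v : List ℕ} (h : u.Sublist v) : DecDom u v :=
  fun s hs hd => ⟨s, hs.trans h, hd, rfl, fun i hi => ⟨⟨i, hi, le_rfl⟩, ⟨i, hi, le_rfl⟩⟩⟩

theorem DecDom.trans {u v w : List ℕ} (h₁ : DecDom u v) (h₂ : DecDom v w) : DecDom u w := by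
  intro s hs hd
  obtain ⟨t, ht, htd, hl, hb⟩ := h₁ s hs hd
  obtain ⟨t', ht', htd', hl', hb'⟩ := h₂ t ht htd
  refine ⟨t', ht', htd', hl'.trans hl, fun i hi => ?_⟩
  obtain ⟨⟨j, hj, hij⟩, ⟨k, hk, hki⟩⟩ := hb' i hi
  obtain ⟨⟨j', hj', hij'⟩, -⟩ := hb j hj
  obtain ⟨-, ⟨k', hk', hki'⟩⟩ := hb k hk
  exact ⟨⟨j', hj', hij.trans hij'⟩, ⟨k', hk', hki'.trans hki⟩⟩

/-- This is what the bounds in `DecDom` are for: the traded piece stays between entries of the old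
one, so it still fits below what precedes it and above what follows. -/
theorem DecDom.context {u v : List ℕ} (h : DecDom u v) (p q : List ℕ) :
    DecDom (p ++ u ++ q) (p ++ v ++ q) := by
  intro s hs hd
  obtain ⟨s', s₃, rfl, hs', hs₃⟩ := List.sublist_append_iff.1 hs
  obtain ⟨s₁, s₂, rfl, hs₁, hs₂⟩ := List.sublist_append_iff.1 hs'
  rw [List.pairwise_append, List.pairwise_append] at hd
  obtain ⟨⟨hd₁, hd₂, hd₁₂⟩, hd₃, hd₃'⟩ := hd
  obtain ⟨t, ht, htd, hl, hb⟩ := h s₂ hs₂ hd₂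
  refine ⟨s₁ ++ t ++ s₃, (hs₁.append ht).append hs₃, ?_, by simp [hl], ?_⟩
  · rw [List.pairwise_append, List.pairwise_append]
    refine ⟨⟨hd₁, htd, fun a ha i hi => ?_⟩, hd₃, fun i hi e he => ?_⟩
    · obtain ⟨⟨j, hj, hij⟩, -⟩ := hb i hi
      exact hij.trans_lt (hd₁₂ a ha j hj)
    · rcases List.mem_append.1 hi with hi | hi
      · exact hd₃' i (List.mem_append_left _ hi) e he
      · obtain ⟨-, ⟨k, hk, hki⟩⟩ := hb i hi
        exact (hd₃' k (List.mem_append_right _ hk) e he).trans_le hki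
  · intro i hi
    rcases List.mem_append.1 hi with hi | hi
    · rcases List.mem_append.1 hi with hi | hi
      · exact ⟨⟨i, by simp [hi], le_rfl⟩, ⟨i, by simp [hi], le_rfl⟩⟩
      · obtain ⟨⟨j, hj, hij⟩, ⟨k, hk, hki⟩⟩ := hb i hi
        exact ⟨⟨j, by simp [hj], hij⟩, ⟨k, by simp [hk], hki⟩⟩
    · exact ⟨⟨i, by simp [hi], le_rfl⟩, ⟨i, by simp [hi], le_rfl⟩⟩

def DecEquiv (u v : List ℕ) : Prop := DecDom u v ∧ DecDom v u

theorem DecEquiv.refl (u : List ℕ) : DecEquiv u u :=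
  ⟨.of_sublist (.refl u), .of_sublist (.refl u)⟩

theorem DecEquiv.trans {u v w : List ℕ} (h₁ : DecEquiv u v) (h₂ : DecEquiv v w) : DecEquiv u w :=
  ⟨h₁.1.trans h₂.1, h₂.2.trans h₁.2⟩

theorem DecEquiv.context {u v : List ℕ} (h : DecEquiv u v) (p q : List ℕ) :
    DecEquiv (p ++ u ++ q) (p ++ v ++ q) :=
  ⟨h.1.context p q, h.2.context p q⟩

/-! ### Local exchanges for one row and one letter -/

theorem eq_nil_or_singleton_of_sublist {s R : List ℕ} (hs : s.Sublist R)
    (hR : R.Pairwise (· < ·)) (hd : s.Pairwise (· > ·)) : s = [] ∨ ∃ r ∈ R, s = [r] := by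
  match s with
  | [] => exact .inl rfl
  | [r] => exact .inr ⟨r, hs.subset (by simp), rfl⟩
  | a :: b :: l =>
    have h := hR.sublist hs
    simp only [List.pairwise_cons, List.mem_cons, forall_eq_or_imp] at h hd
    have h1 := h.1.1
    have h2 := hd.1.1
    omega

/-- Handles a letter `x` that could not be placed. A decreasing subsequence through `x` has at most
one entry `r` of `R` before it and one entry `e` of `A` after it. `hlow` trades `x, e` for `a, e`,
which frees the place of `x`; `hhigh` trades `r` for the `y` in front. With neither neighbour, any
copy of `x` will do. -/
theorem decDom_absorb {R A : List ℕ} {x : ℕ} {v : List ℕ} (hR : R.Pairwise (· < ·))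
    (hA : A.Pairwise (· < ·)) (hv : (R ++ A).Sublist v) (hx : x ∈ R ++ A)
    (hlow : ∀ e ∈ A, e < x → ∃ a ∈ R, e < a ∧ a ≤ x)
    (hhigh : ∀ r ∈ R, x < r → ∃ y, x < y ∧ y ≤ r ∧ (y :: (R ++ A)).Sublist v) :
    DecDom (R ++ x :: A) v := by
  intro s hs hd
  obtain ⟨s₁, s₂, rfl, hs₁, hs₂⟩ := List.sublist_append_iff.1 hs
  rw [List.pairwise_append] at hd
  obtain ⟨hd₁, hd₂, hd₁₂⟩ := hd
  rcases List.sublist_cons_iff.1 hs₂ with hs₂ | ⟨s₃, rfl, hs₃⟩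
  · exact DecDom.of_sublist hv _ (hs₁.append hs₂) (List.pairwise_append.2 ⟨hd₁, hd₂, hd₁₂⟩)
  rw [List.pairwise_cons] at hd₂
  have hxs : [x].Sublist (R ++ A) := List.singleton_sublist.2 hx
  have key : ∀ l : List ℕ, l.Sublist v → l.Pairwise (· > ·) →
      l.length = (s₁ ++ x :: s₃).length → (∀ i ∈ l, (∃ j ∈ s₁ ++ x :: s₃, i ≤ j) ∧
        ∃ j ∈ s₁ ++ x :: s₃, j ≤ i) → ∃ t : List ℕ, t.Sublist v ∧ t.Pairwise (· > ·) ∧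
      t.length = (s₁ ++ x :: s₃).length ∧ ∀ i ∈ t, (∃ j ∈ s₁ ++ x :: s₃, i ≤ j) ∧
        ∃ j ∈ s₁ ++ x :: s₃, j ≤ i := fun l h1 h2 h3 h4 => ⟨l, h1, h2, h3, h4⟩
  rcases eq_nil_or_singleton_of_sublist hs₁ hR hd₁ with rfl | ⟨r, hr, rfl⟩ <;>
  rcases eq_nil_or_singleton_of_sublist hs₃ hA hd₂.2 with rfl | ⟨e, he, rfl⟩
  · exact key [x] (hxs.trans hv) (by simp) (by simp) (by simp)
  · have hex : e < x := hd₂.1 e (by simp)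
    obtain ⟨a, ha, hea, hax⟩ := hlow e he hex
    refine key [a, e] (((List.singleton_sublist.2 ha).append (List.singleton_sublist.2 he)).trans
      hv) (by simpa using hea) (by simp) ?_
    simp
    omega
  · have hxr : x < r := hd₁₂ r (by simp) x (by simp)
    obtain ⟨y, hxy, hyr, hyv⟩ := hhigh r hr hxr
    refine key [y, x] ((hxs.cons_cons y).trans hyv) (by simpa using hxy) (by simp) ?_
    simp
    omega
  · have hxr : x < r := hd₁₂ r (by simp) x (by simp)
    have hex : e < x := hd₂.1 e (by simp)
    obtain ⟨a, ha, hea, hax⟩ := hlow e he hex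
    obtain ⟨y, hxy, hyr, hyv⟩ := hhigh r hr hxr
    refine key [y, a, e] ((((List.singleton_sublist.2 ha).append
      (List.singleton_sublist.2 he)).cons_cons y).trans hyv) (by simp; omega) (by simp) ?_
    simp
    omega

/-- The leading `y` can be taken from inside `R` instead. If an entry `r < y` of `R` is also used,
then `r ≤ x`, and the pair `y, r` becomes `y, x`. -/
theorem decDom_bump {R A : List ℕ} {x y : ℕ} (hR : R.Pairwise (· < ·))
    (hy : y ∈ R) (hxy : x < y) (hmin : ∀ r ∈ R, r < y → r ≤ x) :
    DecDom (y :: (R ++ A)) (R ++ x :: A) := by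
  intro s hs hd
  rcases List.sublist_cons_iff.1 hs with hs | ⟨s', rfl, hs'⟩
  · exact DecDom.of_sublist ((List.sublist_cons_self x A).append_left R) _ hs hd
  obtain ⟨s₁, s₂, rfl, hs₁, hs₂⟩ := List.sublist_append_iff.1 hs'
  rw [List.pairwise_cons, List.pairwise_append] at hd
  obtain ⟨hdy, hd₁, hd₂, hd₁₂⟩ := hd
  have hys : [y].Sublist R := List.singleton_sublist.2 hy
  rcases eq_nil_or_singleton_of_sublist hs₁ hR hd₁ with rfl | ⟨r, hr, rfl⟩
  · refine DecDom.of_sublist (hys.append (hs₂.cons x)) _ (.refl _) ?_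
    simpa [hd₂] using hdy
  · have hrx : r ≤ x := hmin r hr (hdy r (by simp))
    have hs₂y : ∀ e ∈ s₂, e < y := fun e he => hdy e (by simp [he])
    have hs₂r : ∀ e ∈ s₂, e < r := fun e he => hd₁₂ r (by simp) e he
    refine ⟨y :: x :: s₂, hys.append (hs₂.cons_cons x), ?_, by simp, ?_⟩
    · simp only [List.pairwise_cons, List.mem_cons, forall_eq_or_imp]
      exact ⟨⟨hxy, hs₂y⟩, fun e he => (hs₂r e he).trans_le hrx, hd₂⟩
    · intro i hi
      simp only [List.mem_cons] at hi
      rcases hi with rfl | rfl | hi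
      · exact ⟨⟨i, by simp, le_rfl⟩, ⟨i, by simp, le_rfl⟩⟩
      · exact ⟨⟨y, by simp, hxy.le⟩, ⟨r, by simp, hrx⟩⟩
      · exact ⟨⟨i, by simp [hi], le_rfl⟩, ⟨i, by simp [hi], le_rfl⟩⟩

/-- The ordinary bump. Decreasing subsequences on either side have at most two entries, and those of
length two can all be traded for `y, x`. -/
theorem decEquiv_replace {a b : List ℕ} {x y : ℕ} (hR : (a ++ y :: b).Pairwise (· < ·))
    (hR' : (a ++ x :: b).Pairwise (· < ·)) (hxy : x < y) :
    DecEquiv (y :: (a ++ x :: b)) (a ++ y :: b ++ [x]) := by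
  have ha : ∀ e ∈ a, e < x := fun e he => (List.pairwise_append.1 hR').2.2 e he x (by simp)
  have hb : ∀ e ∈ b, y < e := (List.pairwise_cons.1 (List.pairwise_append.1 hR).2.1).1
  have hpair : [y, x].Sublist (a ++ y :: b ++ [x]) :=
    (List.singleton_sublist.2 (by simp : y ∈ a ++ y :: b)).append (.refl [x])
  constructor
  · intro s hs hd
    rcases List.sublist_cons_iff.1 hs with hs | ⟨s', rfl, hs'⟩
    · rcases eq_nil_or_singleton_of_sublist hs hR' hd with rfl | ⟨r, hr, rfl⟩
      · exact ⟨[], by simp⟩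
      · exact ⟨[r], List.singleton_sublist.2 (by simp at hr ⊢; tauto), by simp⟩
    · rw [List.pairwise_cons] at hd
      rcases eq_nil_or_singleton_of_sublist hs' hR' hd.2 with rfl | ⟨r, hr, rfl⟩
      · exact ⟨[y], List.singleton_sublist.2 (by simp), by simp⟩
      · have hry : r < y := hd.1 r (by simp)
        have hrx : r ≤ x := by
          simp only [List.mem_append, List.mem_cons] at hr
          rcases hr with hr | rfl | hr
          · exact (ha r hr).le
          · exact le_rfl
          · exact absurd (hb r hr) (by omega)
        refine ⟨[y, x], hpair, by simpa using hxy, by simp, ?_⟩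
        simp
        omega
  · intro s hs hd
    obtain ⟨s₁, s₂, rfl, hs₁, hs₂⟩ := List.sublist_append_iff.1 hs
    rw [List.pairwise_append] at hd
    obtain ⟨hd₁, hd₂, hd₁₂⟩ := hd
    have hx' : [x].Sublist (a ++ x :: b) := List.singleton_sublist.2 (by simp)
    rcases eq_nil_or_singleton_of_sublist hs₁ hR hd₁ with rfl | ⟨r, hr, rfl⟩ <;>
    rcases eq_nil_or_singleton_of_sublist hs₂ (by simp) hd₂ with rfl | ⟨e, he, rfl⟩
    · exact ⟨[], by simp⟩
    · exact ⟨[e], List.singleton_sublist.2 (by simp at he ⊢; tauto), by simp⟩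
    · exact ⟨[r], List.singleton_sublist.2 (by simp at hr ⊢; tauto), by simp⟩
    · obtain rfl : e = x := by simpa using he
      have her : e < r := hd₁₂ r (by simp) e (by simp)
      have hyr : y ≤ r := by
        simp only [List.mem_append, List.mem_cons] at hr
        rcases hr with hr | rfl | hr
        · exact absurd (ha r hr) (by omega)
        · exact le_rfl
        · exact (hb r hr).le
      refine ⟨[y, e], hx'.cons_cons y, by simpa using hxy, by simp, ?_⟩
      simp
      omega

/-! ### Obstructions to placing a letter -/

/-- The column condition between a row and a lower row. -/
def ColLt (R S : List ℕ) : Prop :=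
  S.length ≤ R.length ∧ ∀ j < S.length, R.getD j 0 < S.getD j 0

theorem ColLt.trans {R S T : List ℕ} (h₁ : ColLt R S) (h₂ : ColLt S T) : ColLt R T :=
  ⟨h₂.1.trans h₁.1, fun j hj => (h₁.2 j (hj.trans_le h₂.1)).trans (h₂.2 j hj)⟩

theorem isIncreasing_iff {T : List (List ℕ)} : IsIncreasing T ↔
    (∀ R ∈ T, R ≠ []) ∧ (∀ R ∈ T, R.Pairwise (· < ·)) ∧ T.Pairwise ColLt := Iff.rfl

theorem isIncreasing_insert_row {above rest : List (List ℕ)} {R : List ℕ}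
    (h : IsIncreasing (above ++ rest)) (hne : R ≠ []) (hR : R.Pairwise (· < ·))
    (hrest : ∀ S ∈ rest, ColLt R S) (hlast : ∀ B A, above = B ++ [A] → ColLt A R) :
    IsIncreasing (above ++ R :: rest) := by
  rw [isIncreasing_iff] at h ⊢
  obtain ⟨h1, h2, h3⟩ := h
  rw [List.pairwise_append] at h3
  obtain ⟨h3, h4, h5⟩ := h3
  refine ⟨?_, ?_, ?_⟩
  · intro S hS
    simp only [List.mem_append, List.mem_cons] at hS
    rcases hS with hS | rfl | hS
    · exact h1 S (by simp [hS])
    · exact hne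
    · exact h1 S (by simp [hS])
  · intro S hS
    simp only [List.mem_append, List.mem_cons] at hS
    rcases hS with hS | rfl | hS
    · exact h2 S (by simp [hS])
    · exact hR
    · exact h2 S (by simp [hS])
  · rw [List.pairwise_append, List.pairwise_cons]
    refine ⟨h3, ⟨hrest, h4⟩, fun C hC S hS => ?_⟩
    rcases List.mem_cons.1 hS with rfl | hS
    · rcases List.eq_nil_or_concat above with rfl | ⟨B, A, rfl⟩
      · simp at hC
      · have hA := hlast B A (by simp)
        rw [List.concat_eq_append, List.pairwise_append] at h3
        simp only [List.concat_eq_append, List.mem_append, List.mem_singleton] at hC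
        rcases hC with hC | rfl
        · exact (h3.2.2 C hC A (by simp)).trans hA
        · exact hA
    · exact h5 C hC S hS

/-- The place of `x` is weakly left of the box of `z`, since the entry below that box exceeds `x`.
Strictly left of it, the entry of `A` over the place is less than `z ≤ x`. So the column condition
fails only when the place is right below `z` and `z = x`; each smaller entry of `A` then has an
entry of `a` below it, which is the `ρ` required. -/
theorem colLt_insert_or {A a r : List ℕ} {x : ℕ} (hA : A.Pairwise (· < ·))
    (hAR : ColLt A (a ++ r)) (hax : ∀ e ∈ a, e < x)
    (hpos : ∃ c z d, A = c ++ z :: d ∧ z ≤ x ∧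
      (c.length < (a ++ r).length → x < (a ++ r).getD c.length 0)) :
    ColLt A (a ++ x :: r.tail) ∨ (x ∈ A ∧ ∀ e ∈ A, e < x → ∃ ρ ∈ a ++ r, e < ρ ∧ ρ ≤ x) := by
  obtain ⟨c, z, d, rfl, hzx, hc⟩ := hpos
  have hcz : ∀ e ∈ c, e < z := fun e he => (List.pairwise_append.1 hA).2.2 e he z (by simp)
  have hzd : ∀ e ∈ d, z < e := (List.pairwise_cons.1 (List.pairwise_append.1 hA).2.1).1
  have hac : a.length ≤ c.length := by
    by_contra! hlt
    have h1 := hc (by simp; omega)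
    rw [List.getD_append _ _ _ _ hlt, List.getD_eq_getElem _ _ hlt] at h1
    exact absurd (hax _ (List.getElem_mem hlt)) (by omega)
  obtain ⟨hlen, hcol⟩ := hAR
  by_cases hcase : z = x ∧ a.length = c.length
  · obtain ⟨rfl, hl⟩ := hcase
    refine .inr ⟨by simp, fun e he hez => ?_⟩
    simp only [List.mem_append, List.mem_cons] at he
    rcases he with he | rfl | he
    · obtain ⟨i, hi, rfl⟩ := List.getElem_of_mem he
      have hia : i < a.length := by omega
      have h1 := hcol i (by simp; omega)
      rw [List.getD_append _ _ _ _ hi, List.getD_append _ _ _ _ hia, List.getD_eq_getElem _ _ hi,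
        List.getD_eq_getElem _ _ hia] at h1
      exact ⟨a[i], by simp, h1, (hax _ (List.getElem_mem hia)).le⟩
    · omega
    · exact absurd (hzd e he) (by omega)
  · refine .inl ⟨?_, fun j hj => ?_⟩
    · simp only [List.length_append, List.length_cons, List.length_tail] at hlen ⊢
      omega
    · rcases lt_trichotomy j a.length with hja | rfl | hja
      · have h1 := hcol j (by simp; omega)
        rwa [List.getD_append _ _ _ _ hja] at h1 ⊢
      · rw [List.getD_append_right _ _ _ _ le_rfl]
        simp only [Nat.sub_self, List.getD_cons_zero]
        rcases hac.lt_or_eq with hlt | heq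
        · rw [List.getD_append _ _ _ _ hlt, List.getD_eq_getElem _ _ hlt]
          exact (hcz _ (List.getElem_mem hlt)).trans_le hzx
        · rw [heq, List.getD_append_right _ _ _ _ le_rfl]
          simp only [Nat.sub_self, List.getD_cons_zero]
          omega
      · simp only [List.length_append, List.length_cons, List.length_tail] at hj
        have h1 := hcol j (by simp; omega)
        rw [List.getD_append_right _ _ _ _ hja.le] at h1 ⊢
        obtain ⟨k, hk⟩ : ∃ k, j - a.length = k + 1 := ⟨j - a.length - 1, by omega⟩
        rw [hk] at h1 ⊢
        cases r with
        | nil => simp at hj; omega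
        | cons y b => simpa using h1

/-- If putting `x` in its place in the row `a ++ r` does not give an increasing tableau, then `x`
is in that row already or in the row above, right over that place. -/
theorem mem_of_not_isIncreasing {above rest : List (List ℕ)} {a r : List ℕ} {x : ℕ}
    (h : IsIncreasing (above ++ rest)) (hR : (a ++ r).Pairwise (· < ·))
    (hax : ∀ e ∈ a, e ≤ x) (hxr : ∀ e ∈ r, x < e)
    (hrest : ∀ S ∈ rest, ColLt (a ++ r) S)
    (hlast : ∀ B A, above = B ++ [A] → ColLt A (a ++ r) ∧ ∃ c z d, A = c ++ z :: d ∧ z ≤ x ∧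
      (c.length < (a ++ r).length → x < (a ++ r).getD c.length 0))
    (hnot : ¬ IsIncreasing (above ++ (a ++ x :: r.tail) :: rest)) :
    x ∈ a ++ r ∨ ∃ B A, above = B ++ [A] ∧ x ∈ A ∧
      ∀ e ∈ A, e < x → ∃ ρ ∈ a ++ r, e < ρ ∧ ρ ≤ x := by
  by_contra! hcon
  obtain ⟨hx, hcon⟩ := hcon
  have hax' : ∀ e ∈ a, e < x := fun e he =>
    (hax e he).lt_of_ne (by rintro rfl; exact hx (by simp [he]))
  refine hnot (isIncreasing_insert_row h (by simp) ?_ ?_ ?_)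
  · rw [List.pairwise_append] at hR ⊢
    refine ⟨hR.1, List.pairwise_cons.2 ⟨fun e he => hxr e (List.mem_of_mem_tail he),
      hR.2.1.sublist (List.tail_sublist r)⟩, fun e he f hf => ?_⟩
    rcases List.mem_cons.1 hf with rfl | hf
    · exact hax' e he
    · exact hR.2.2 e he f (List.mem_of_mem_tail hf)
  · intro S hS
    obtain ⟨hl, hcol⟩ := hrest S hS
    refine ⟨hl.trans (by simp; omega), fun j hj => ?_⟩
    have h1 := hcol j hj
    rcases lt_trichotomy j a.length with hja | rfl | hja
    · rwa [List.getD_append _ _ _ _ hja] at h1 ⊢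
    · cases r with
      | nil => simp at hl; omega
      | cons y b =>
        rw [List.getD_append_right _ _ _ _ le_rfl] at h1 ⊢
        simp only [Nat.sub_self, List.getD_cons_zero] at h1 ⊢
        exact (hxr y (by simp)).trans h1
    · rw [List.getD_append_right _ _ _ _ hja.le] at h1 ⊢
      obtain ⟨k, hk⟩ : ∃ k, j - a.length = k + 1 := ⟨j - a.length - 1, by omega⟩
      rw [hk] at h1 ⊢
      cases r with
      | nil => simp at hl; omega
      | cons y b => simpa using h1
  · intro B A hBA
    have hA : A.Pairwise (· < ·) := h.2.1 A (by simp [hBA])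
    rcases colLt_insert_or hA (hlast B A hBA).1 hax' (hlast B A hBA).2 with h1 | ⟨h1, h2⟩
    · exact h1
    · obtain ⟨e, he, hex, h3⟩ := hcon B A hBA h1
      obtain ⟨ρ, h4, h5, h6⟩ := h2 e he hex
      exact absurd (h3 ρ h4 h5) (by omega)

theorem le_of_min?_filter_eq_none {R : List ℕ} {x : ℕ}
    (h : (R.filter (fun z => x < z)).min? = none) : ∀ e ∈ R, e ≤ x := by
  simpa using h

theorem exists_split_of_min?_filter {R : List ℕ} {x y : ℕ} (hR : R.Pairwise (· < ·))
    (h : (R.filter (fun z => x < z)).min? = some y) :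
    ∃ a b, R = a ++ y :: b ∧ (∀ e ∈ a, e ≤ x) ∧ x < y ∧ (∀ e ∈ b, y < e) ∧
      R.replace y x = a ++ x :: b := by
  obtain ⟨hmem, hmin⟩ := List.min?_eq_some_iff.1 h
  simp only [List.mem_filter, decide_eq_true_eq] at hmem hmin
  obtain ⟨a, b, rfl⟩ := List.append_of_mem hmem.1
  rw [List.pairwise_append, List.pairwise_cons] at hR
  have hay : ∀ e ∈ a, e < y := fun e he => hR.2.2 e he y (by simp)
  refine ⟨a, b, rfl, fun e he => ?_, hmem.2, hR.2.1.1, ?_⟩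
  · by_contra! hlt
    have := hmin e ⟨by simp [he], hlt⟩
    have := hay e he
    omega
  · rw [List.replace_append_right (fun hy => (hay y hy).false)]
    simp

/-! ### Insertion and the reading word -/

/-- The row reading word of a tableau: the rows from bottom to top. -/
def readingWord (T : List (List ℕ)) : List ℕ := T.reverse.flatten

theorem readingWord_append (S T : List (List ℕ)) :
    readingWord (S ++ T) = readingWord T ++ readingWord S := by
  simp [readingWord]

theorem readingWord_nil : readingWord [] = [] := rfl

theorem readingWord_singleton (R : List ℕ) : readingWord [R] = R := by
  simp [readingWord]

theorem readingWord_cons (R : List ℕ) (T : List (List ℕ)) :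
    readingWord (R :: T) = readingWord T ++ R := by
  simp [readingWord]

/-- The insertion in progress is at a place that Hecke insertion can reach: `x` has come out of a
box of the last row of `above`, and it is less than the entry below that box. -/
def Reachable (above below : List (List ℕ)) (x : ℕ) : Prop :=
  ∀ B A, above = B ++ [A] → ∃ c z d, A = c ++ z :: d ∧ z ≤ x ∧
    ∀ S ∈ below.head?, c.length < S.length → x < S.getD c.length 0

theorem Reachable.next {above rest : List (List ℕ)} {a b : List ℕ} {x y : ℕ} (hxy : x ≤ y)
    (hrest : ∀ S ∈ rest, ColLt (a ++ y :: b) S) :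
    Reachable (above ++ [a ++ x :: b]) rest y := by
  intro B A hBA
  obtain ⟨-, rfl⟩ := List.append_inj' hBA rfl |>.imp_right (fun h => (List.singleton_inj.1 h))
  refine ⟨a, x, b, rfl, hxy, fun S hS hlt => ?_⟩
  have h1 := (hrest S (List.mem_of_mem_head? hS)).2 _ hlt
  rw [List.getD_append_right _ _ _ _ le_rfl] at h1
  simpa using h1

/-- Converse to `isIncreasing_insert_row`: it isolates the row being treated from its surroundings.
-/
theorem isIncreasing_drop_row {above rest : List (List ℕ)} {R : List ℕ}
    (h : IsIncreasing (above ++ R :: rest)) : IsIncreasing (above ++ rest) ∧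
    R.Pairwise (· < ·) ∧ (∀ S ∈ rest, ColLt R S) ∧ ∀ B A, above = B ++ [A] → ColLt A R := by
  rw [isIncreasing_iff] at h ⊢
  obtain ⟨h1, h2, h3⟩ := h
  have hs : (above ++ rest).Sublist (above ++ R :: rest) :=
    (List.sublist_cons_self R rest).append_left above
  refine ⟨⟨fun S hS => h1 S (hs.subset hS), fun S hS => h2 S (hs.subset hS), h3.sublist hs⟩,
    h2 R (by simp), ?_, ?_⟩
  · exact (List.pairwise_cons.1 (List.pairwise_append.1 h3).2.1).1
  · rintro B A rfl
    exact (List.pairwise_append.1 h3).2.2 A (by simp) R (by simp)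

/-- By induction down the rows, only the exchange at the current row remains, all other rows being
context. If `x` is blocked by the row `A` above, `A` has to join the exchange, and only the rows
over `A` are context. -/
theorem decEquiv_insertBelow (above below : List (List ℕ)) (x : ℕ)
    (h : IsIncreasing (above ++ below)) (hr : Reachable above below x) :
    DecEquiv (readingWord (insertBelow above below x))
      (readingWord below ++ [x] ++ readingWord above) := by
  induction below generalizing above x with
  | nil =>
    rw [insertBelow]
    split_ifs with h1
    · rw [readingWord_append, readingWord_singleton]
      exact .refl _
    · have h2 := mem_of_not_isIncreasing (a := []) (r := []) (x := x) h (by simp) (by simp)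
        (by simp) (by simp) (fun B A hBA => ⟨⟨by simp, by simp⟩, by
          obtain ⟨c, z, d, h3, h4, -⟩ := hr B A hBA
          exact ⟨c, z, d, h3, h4, by simp⟩⟩) h1
      rcases h2 with h2 | ⟨B, A, rfl, hxA, hlow⟩
      · simp at h2
      · have hA : A.Pairwise (· < ·) := h.2.1 A (by simp)
        have h4 : DecEquiv A (x :: A) := ⟨.of_sublist (List.sublist_cons_self x A),
          decDom_absorb (R := []) (by simp) hA (by simp) (by simpa using hxA) (by simpa using hlow)
            (by simp)⟩
        simpa [readingWord] using h4.context [] (readingWord B)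
  | cons R rest ih =>
    obtain ⟨h0, hR, hrest, hlast⟩ := isIncreasing_drop_row h
    have hlast' : ∀ B A, above = B ++ [A] → ColLt A R ∧ ∃ c z d, A = c ++ z :: d ∧ z ≤ x ∧
        (c.length < R.length → x < R.getD c.length 0) := by
      intro B A hBA
      obtain ⟨c, z, d, h3, h4, h5⟩ := hr B A hBA
      exact ⟨hlast B A hBA, c, z, d, h3, h4, h5 R (by simp)⟩
    rw [insertBelow]
    split
    · rename_i hnone
      have hle := le_of_min?_filter_eq_none hnone
      split_ifs with h1
      · simp only [readingWord_append, readingWord_cons, List.append_assoc]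
        exact .refl _
      · have h2 := mem_of_not_isIncreasing (a := R) (r := []) (x := x) h0 (by simpa using hR) hle
          (by simp) (by simpa using hrest) (by simpa using hlast') (by simpa using h1)
        simp only [List.append_nil] at h2
        -- Vacuous: no entry of `R` exceeds `x` here.
        have hhigh : ∀ A, ∀ r ∈ R, x < r →
            ∃ y, x < y ∧ y ≤ r ∧ (y :: (R ++ A)).Sublist (R ++ A) :=
          fun A r hr hxr => absurd (hle r hr) (by omega)
        rcases h2 with h2 | ⟨B, A, rfl, hxA, hlow⟩
        · have h4 : DecEquiv R (R ++ [x]) := ⟨.of_sublist (List.sublist_append_left _ _),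
            decDom_absorb hR (A := []) (by simp) (by simp) (by simpa using h2) (by simp)
              (by simpa using hhigh [])⟩
          simpa [readingWord_append, readingWord_cons] using
            h4.context (readingWord rest) (readingWord above)
        · have hA : A.Pairwise (· < ·) := h.2.1 A (by simp)
          have h4 : DecEquiv (R ++ A) (R ++ x :: A) :=
            ⟨.of_sublist ((List.sublist_cons_self x A).append_left R),
            decDom_absorb hR hA (.refl _) (by simp [hxA]) hlow (hhigh A)⟩
          simpa [readingWord_append, readingWord_cons, readingWord_nil] using
            h4.context (readingWord rest) (readingWord B)
    · rename_i y hsome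
      obtain ⟨a, b, rfl, hax, hxy, hyb, hrep⟩ := exists_split_of_min?_filter hR hsome
      rw [hrep]
      have hxr : ∀ e ∈ y :: b, x < e := by
        intro e he
        rcases List.mem_cons.1 he with rfl | he
        · exact hxy
        · exact hxy.trans (hyb e he)
      split_ifs with h1
      · have h2 := ih (above ++ [a ++ x :: b]) y (by simpa using h1) (.next hxy.le hrest)
        refine h2.trans ?_
        have h4 := decEquiv_replace hR (h1.2.1 _ (by simp)) hxy
        simpa [readingWord_append, readingWord_cons, readingWord_nil] using
            h4.context (readingWord rest) (readingWord above)
      · have h2 := ih (above ++ [a ++ y :: b]) y (by simpa using h) (.next le_rfl hrest)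
        refine h2.trans ?_
        have hmin : ∀ r ∈ a ++ y :: b, r < y → r ≤ x := by
          intro r hr hry
          simp only [List.mem_append, List.mem_cons] at hr
          rcases hr with hr | rfl | hr
          · exact hax r hr
          · omega
          · exact absurd (hyb r hr) (by omega)
        -- The bumped letter itself serves as `y'`, being the least entry of the row above `x`.
        have hhigh : ∀ A, ∀ r ∈ a ++ y :: b, x < r →
            ∃ y', x < y' ∧ y' ≤ r ∧
              (y' :: (a ++ y :: b ++ A)).Sublist (y :: (a ++ y :: b ++ A)) := by
          intro A r hr hxr
          refine ⟨y, hxy, ?_, .refl _⟩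
          by_contra! hlt
          exact absurd (hmin r hr hlt) (by omega)
        have h3 := mem_of_not_isIncreasing (a := a) (r := y :: b) (x := x) h0 hR hax
          hxr hrest hlast' h1
        rcases h3 with h3 | ⟨B, A, rfl, hxA, hlow⟩
        · have h4 : DecEquiv (y :: (a ++ y :: b ++ [])) (a ++ y :: b ++ [x]) :=
            ⟨decDom_bump hR (by simp) hxy hmin,
            decDom_absorb hR (A := []) (by simp) (by simp) (by simpa using h3) (by simp)
              (hhigh [])⟩
          simpa [readingWord_append, readingWord_cons, readingWord_nil] using
            h4.context (readingWord rest) (readingWord above)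
        · have hA : A.Pairwise (· < ·) := h.2.1 A (by simp)
          have h4 : DecEquiv (y :: (a ++ y :: b ++ A)) (a ++ y :: b ++ x :: A) :=
            ⟨decDom_bump hR (by simp) hxy hmin,
            decDom_absorb hR hA (List.sublist_cons_self _ _)
              (List.mem_append_right _ hxA) hlow (hhigh A)⟩
          simpa [readingWord_append, readingWord_cons, readingWord_nil] using
            h4.context (readingWord rest) (readingWord B)

theorem insertionTableau_concat (w : List ℕ) (x : ℕ) :
    insertionTableau (w ++ [x]) = heckeInsert (insertionTableau w) x := by
  simp [insertionTableau]

theorem decEquiv_readingWord_insertionTableau (w : List ℕ) :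
    DecEquiv (readingWord (insertionTableau w)) w := by
  induction w using List.reverseRecOn with
  | nil => exact .refl _
  | append_singleton w x ih =>
    rw [insertionTableau_concat]
    have h1 := decEquiv_insertBelow [] (insertionTableau w) x (isIncreasing_insertionTableau w)
      (fun B A h => by simp at h)
    refine h1.trans ?_
    simpa [readingWord] using ih.context [] [x]

/-! ### Number of rows and decreasing subsequences -/

/-- The witness is the first column read upwards; rows are nonempty, so the default value of `getD`
never occurs. -/
theorem exists_dec_sublist_readingWord {T : List (List ℕ)} (hT : IsIncreasing T) :
    ∃ s : List ℕ, s.Sublist (readingWord T) ∧ s.Pairwise (· > ·) ∧ s.length = T.length ∧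
      ∀ i ∈ s, ∃ R ∈ T, i = R.getD 0 0 := by
  induction T with
  | nil => exact ⟨[], by simp⟩
  | cons R T ih =>
    obtain ⟨h0, hR, hrest, -⟩ := isIncreasing_drop_row (above := []) hT
    obtain ⟨s, hs, hd, hl, hc⟩ := ih h0
    have hne : R ≠ [] := hT.1 R (by simp)
    refine ⟨s ++ [R.getD 0 0], ?_, ?_, by simp [hl], ?_⟩
    · rw [readingWord_cons]
      refine hs.append (List.singleton_sublist.2 ?_)
      have hpos : 0 < R.length := List.length_pos_iff.2 hne
      rw [List.getD_eq_getElem _ _ hpos]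
      exact List.getElem_mem hpos
    · rw [List.pairwise_append]
      refine ⟨hd, by simp, fun i hi e he => ?_⟩
      obtain rfl := List.mem_singleton.1 he
      obtain ⟨S, hS, rfl⟩ := hc i hi
      exact (hrest S hS).2 0 (List.length_pos_iff.2 (h0.1 S (by simpa using hS)))
    · intro i hi
      rcases List.mem_append.1 hi with hi | hi
      · obtain ⟨S, hS, rfl⟩ := hc i hi
        exact ⟨S, by simp [hS], rfl⟩
      · exact ⟨R, by simp, List.mem_singleton.1 hi⟩

/-- A decreasing subsequence meets each increasing row at most once. -/
theorem length_le_of_dec_sublist_readingWord {T : List (List ℕ)}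
    (hT : ∀ R ∈ T, R.Pairwise (· < ·)) {s : List ℕ} (hs : s.Sublist (readingWord T))
    (hd : s.Pairwise (· > ·)) : s.length ≤ T.length := by
  induction T generalizing s with
  | nil => simp_all [readingWord]
  | cons R T ih =>
    rw [readingWord_cons] at hs
    obtain ⟨s₁, s₂, rfl, hs₁, hs₂⟩ := List.sublist_append_iff.1 hs
    rw [List.pairwise_append] at hd
    have h1 := ih (fun S hS => hT S (by simp [hS])) hs₁ hd.1
    rcases eq_nil_or_singleton_of_sublist hs₂ (hT R (by simp)) hd.2.1 with rfl | ⟨r, -, rfl⟩ <;>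
    · simp
      omega

/-- `k` is the largest length of a subsequence of `w` in which any two entries are related by
`r`. -/
def IsLongest (r : ℕ → ℕ → Prop) (w : List ℕ) (k : ℕ) : Prop :=
  (∃ s : List ℕ, s.Sublist w ∧ s.Pairwise r ∧ s.length = k) ∧
    ∀ s : List ℕ, s.Sublist w → s.Pairwise r → s.length ≤ k

theorem IsLongest.unique {r : ℕ → ℕ → Prop} {w : List ℕ} {k l : ℕ} (hk : IsLongest r w k)
    (hl : IsLongest r w l) : k = l := by
  obtain ⟨⟨s, hs, hsr, rfl⟩, hk⟩ := hk
  obtain ⟨⟨t, ht, htr, rfl⟩, hl⟩ := hl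
  exact le_antisymm (hl s hs hsr) (hk t ht htr)

theorem IsLongest.reverse {r : ℕ → ℕ → Prop} {w : List ℕ} {k : ℕ} (h : IsLongest r w k) :
    IsLongest (Function.swap r) w.reverse k := by
  obtain ⟨⟨s, hs, hsr, rfl⟩, hk⟩ := h
  refine ⟨⟨s.reverse, hs.reverse, List.pairwise_reverse.2 hsr, by simp⟩, fun t ht htr => ?_⟩
  have h1 := hk t.reverse (by simpa using ht.reverse) (List.pairwise_reverse.2 htr)
  simpa using h1

/-- The number of rows of the insertion tableau is the length of the longest strictly decreasing
subsequence. -/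
theorem isLongest_gt_length_insertionTableau (w : List ℕ) :
    IsLongest (· > ·) w (insertionTableau w).length := by
  have hT := isIncreasing_insertionTableau w
  obtain ⟨h1, h2⟩ := decEquiv_readingWord_insertionTableau w
  constructor
  · obtain ⟨s, hs, hd, hl, -⟩ := exists_dec_sublist_readingWord hT
    obtain ⟨t, ht, htd, htl, -⟩ := h1 s hs hd
    exact ⟨t, ht, htd, htl.trans hl⟩
  · intro s hs hd
    obtain ⟨t, ht, htd, htl, -⟩ := h2 s hs hd
    exact htl ▸ length_le_of_dec_sublist_readingWord hT.2.1 ht htd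

/-! ### First row and increasing subsequences -/

theorem prefix_insertBelow (above below : List (List ℕ)) (x : ℕ) :
    above <+: insertBelow above below x := by
  induction below generalizing above x with
  | nil =>
    rw [insertBelow]
    split_ifs
    · exact List.prefix_append _ _
    · exact List.prefix_rfl
  | cons R rest ih =>
    rw [insertBelow]
    split
    · split_ifs <;> exact List.prefix_append _ _
    · split_ifs <;> exact (List.prefix_append _ _).trans (ih _ _)

/-- The first row of a tableau (empty if there is none). -/
def firstRow (T : List (List ℕ)) : List ℕ := T.headD []

theorem firstRow_insertBelow_singleton (R : List ℕ) (below : List (List ℕ)) (x : ℕ) :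
    firstRow (insertBelow [R] below x) = R := by
  obtain ⟨t, ht⟩ := prefix_insertBelow [R] below x
  rw [← ht]
  simp [firstRow]

theorem countP_lt_append_singleton {R : List ℕ} {x : ℕ} (hR : ∀ e ∈ R, e < x) (m : ℕ) :
    (R ++ [x]).countP (· < m) = if x < m then max (R.countP (· < m)) (R.countP (· < x) + 1)
      else R.countP (· < m) := by
  rw [List.countP_append, List.countP_singleton]
  have h1 : R.countP (· < x) = R.length := List.countP_eq_length.2 (by simpa using hR)
  have h2 : R.countP (· < m) ≤ R.length := List.countP_le_length
  split_ifs with h3 h4 h4 <;> simp at h3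
  · have h5 : R.countP (· < m) = R.length :=
      List.countP_eq_length.2 (by simpa using fun e he => (hR e he).trans h4)
    omega
  · omega
  · omega
  · omega

theorem countP_lt_of_mem {R : List ℕ} {x : ℕ} (hx : x ∈ R) (m : ℕ) :
    R.countP (· < m) = if x < m then max (R.countP (· < m)) (R.countP (· < x) + 1)
      else R.countP (· < m) := by
  split_ifs with h
  · obtain ⟨a, b, rfl⟩ := List.append_of_mem hx
    have h1 : ∀ l : List ℕ, l.countP (· < x) ≤ l.countP (· < m) := fun l =>
      List.countP_mono_left (fun e _ he => by simp at he ⊢; omega)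
    have ha := h1 a
    have hb := h1 b
    simp only [List.countP_append, List.countP_cons, h, lt_self_iff_false, decide_true,
      decide_false, if_true, Bool.false_eq_true, if_false]
    omega
  · rfl

theorem countP_lt_replace {a b : List ℕ} {x y : ℕ} (ha : ∀ e ∈ a, e < x) (hxy : x < y)
    (hb : ∀ e ∈ b, y < e) (m : ℕ) :
    (a ++ x :: b).countP (· < m) = if x < m then
      max ((a ++ y :: b).countP (· < m)) ((a ++ y :: b).countP (· < x) + 1)
      else (a ++ y :: b).countP (· < m) := by
  have hax : a.countP (· < x) = a.length := List.countP_eq_length.2 (by simpa using ha)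
  have hb0 : ∀ k ≤ y, b.countP (· < k) = 0 := fun k hk =>
    List.countP_eq_zero.2 (fun e he => by have := hb e he; simp; omega)
  have hbx := hb0 x hxy.le
  have hbm := hb0 m
  have ham : x < m → a.countP (· < m) = a.length := fun h =>
    List.countP_eq_length.2 (by simpa using fun e he => (ha e he).trans h)
  simp only [List.countP_append, List.countP_cons, decide_eq_true_eq]
  split_ifs <;> omega

/-- One recursion covers every outcome: `x` is adjoined, replaces an entry, or is already present.
With no row above, the last is the only way placement can fail. -/
theorem countP_firstRow_heckeInsert {T : List (List ℕ)} (hT : IsIncreasing T) (x m : ℕ) :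
    (firstRow (heckeInsert T x)).countP (· < m) =
      if x < m then max ((firstRow T).countP (· < m)) ((firstRow T).countP (· < x) + 1)
      else (firstRow T).countP (· < m) := by
  cases T with
  | nil =>
    have h1 : IsIncreasing [[x]] := by simp [IsIncreasing]
    simp [heckeInsert, insertBelow, h1, firstRow]
  | cons R rest =>
    obtain ⟨h0, hR, hrest, -⟩ := isIncreasing_drop_row (above := []) hT
    rw [heckeInsert, insertBelow, show firstRow (R :: rest) = R from rfl]
    split
    · rename_i hnone
      have hle := le_of_min?_filter_eq_none hnone
      by_cases h1 : IsIncreasing ([] ++ (R ++ [x]) :: rest)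
      · rw [if_pos h1]
        have h2 : (R ++ [x]).Pairwise (· < ·) := h1.2.1 _ (by simp)
        exact countP_lt_append_singleton
          (fun e he => (List.pairwise_append.1 h2).2.2 e he x (by simp)) m
      · rw [if_neg h1]
        have h2 := mem_of_not_isIncreasing (above := []) (a := R) (r := []) (x := x) h0
          (by simpa using hR) hle (by simp) (by simpa using hrest) (by simp) (by simpa using h1)
        exact countP_lt_of_mem ((List.append_nil R ▸ h2).resolve_right (by simp)) m
    · rename_i y hsome
      obtain ⟨a, b, rfl, hax, hxy, hyb, hrep⟩ := exists_split_of_min?_filter hR hsome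
      rw [hrep]
      by_cases h1 : IsIncreasing ([] ++ (a ++ x :: b) :: rest)
      · have h2 : (a ++ x :: b).Pairwise (· < ·) := h1.2.1 _ (by simp)
        rw [if_pos h1, List.nil_append, firstRow_insertBelow_singleton]
        exact countP_lt_replace
          (fun e he => (List.pairwise_append.1 h2).2.2 e he x (by simp)) hxy hyb m
      · rw [if_neg h1, List.nil_append, firstRow_insertBelow_singleton]
        have h2 := mem_of_not_isIncreasing (above := []) (a := a) (r := y :: b) (x := x) h0 hR hax
          (by
            intro e he
            rcases List.mem_cons.1 he with rfl | he
            · exact hxy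
            · exact hxy.trans (hyb e he)) hrest (by simp) h1
        exact countP_lt_of_mem (h2.resolve_right (by simp)) m

/-- All thresholds `m` are needed together: an increasing subsequence ending in the new letter `x`
extends one among letters below `x`, so the step for `m` uses the hypothesis at `x` too. -/
theorem isLongest_countP_firstRow (w : List ℕ) (m : ℕ) :
    IsLongest (· < ·) (w.filter (· < m)) ((firstRow (insertionTableau w)).countP (· < m)) := by
  induction w using List.reverseRecOn generalizing m with
  | nil => exact ⟨⟨[], by simp [insertionTableau, firstRow]⟩, by simp⟩
  | append_singleton w x ih =>
    rw [insertionTableau_concat,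
      countP_firstRow_heckeInsert (isIncreasing_insertionTableau w)]
    split_ifs with hxm
    · obtain ⟨⟨s, hs, hsr, hsl⟩, hm⟩ := ih m
      obtain ⟨⟨t, ht, htr, htl⟩, hx⟩ := ih x
      rw [List.filter_append, List.filter_singleton, decide_eq_true hxm, cond_true]
      have hsub : (w.filter (· < x)).Sublist (w.filter (· < m)) :=
        List.monotone_filter_right w (fun e he => by simp at he ⊢; omega)
      constructor
      · rcases le_total ((firstRow (insertionTableau w)).countP (· < m))
          ((firstRow (insertionTableau w)).countP (· < x) + 1) with h | h
        · rw [max_eq_right h]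
          refine ⟨t ++ [x], (ht.trans hsub).append (.refl _), ?_, by simp [htl]⟩
          rw [List.pairwise_append]
          refine ⟨htr, by simp, fun e he f hf => ?_⟩
          obtain rfl := List.mem_singleton.1 hf
          simpa using (List.mem_filter.1 (ht.subset he)).2
        · rw [max_eq_left h]
          exact ⟨s, hs.trans (List.sublist_append_left _ _), hsr, hsl⟩
      · intro l hl hlr
        obtain ⟨l₁, l₂, rfl, hl₁, hl₂⟩ := List.sublist_append_iff.1 hl
        rw [List.pairwise_append] at hlr
        rcases List.sublist_singleton.1 hl₂ with rfl | rfl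
        · exact le_max_of_le_left (by simpa using hm l₁ hl₁ hlr.1)
        · refine le_max_of_le_right ?_
          have h1 : l₁.Sublist (w.filter (· < x)) := by
            have h2 : l₁.filter (· < x) = l₁ :=
              List.filter_eq_self.2 (fun e he => by simpa using hlr.2.2 e he x (by simp))
            rw [← h2]
            exact (hl₁.trans List.filter_sublist).filter _
          simpa using hx l₁ h1 hlr.1
    · rw [List.filter_append, List.filter_singleton, decide_eq_false hxm, cond_false,
        List.append_nil]
      exact ih m

/-- The length of the first row of the insertion tableau is the length of the longest strictly
increasing subsequence. -/
theorem isLongest_lt_length_firstRow (w : List ℕ) :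
    IsLongest (· < ·) w (firstRow (insertionTableau w)).length := by
  -- A threshold above all letters makes the filter and the count trivial.
  obtain ⟨m, hm⟩ : ∃ m, ∀ e ∈ w ++ firstRow (insertionTableau w), e < m :=
    ⟨(w ++ firstRow (insertionTableau w)).sum + 1,
      fun e he => Nat.lt_succ_of_le (List.le_sum_of_mem he)⟩
  have h := isLongest_countP_firstRow w m
  rwa [List.filter_eq_self.2 (fun e he => by simpa using hm e (by simp [he])),
    List.countP_eq_length.2 (fun e he => by simpa using hm e (by simp [he]))] at h

/-! ### Passage to shapes and reversal -/

theorem rowLen_zero_heckeshape (w : List ℕ) :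
    (heckeshape w).rowLen 0 = (firstRow (insertionTableau w)).length := by
  refine eq_of_forall_lt_iff fun j => ?_
  rw [← YoungDiagram.mem_iff_lt_rowLen, heckeshape, YoungDiagram.mem_ofRowLens]
  cases insertionTableau w <;> simp [firstRow]

theorem colLen_zero_heckeshape (w : List ℕ) :
    (heckeshape w).colLen 0 = (insertionTableau w).length := by
  refine eq_of_forall_lt_iff fun i => ?_
  rw [← YoungDiagram.mem_iff_lt_colLen, heckeshape, YoungDiagram.mem_ofRowLens]
  constructor
  · rintro ⟨h, -⟩
    simpa using h
  · intro h
    refine ⟨by simpa using h, ?_⟩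
    simpa [List.length_pos_iff] using
      (isIncreasing_insertionTableau w).1 _ (List.getElem_mem h)

theorem rowLen_zero_heckeshape_eq_colLen_zero_reverse (w : List ℕ) :
    (heckeshape w).rowLen 0 = (heckeshape w.reverse).colLen 0 := by
  rw [rowLen_zero_heckeshape, colLen_zero_heckeshape]
  exact (isLongest_lt_length_firstRow w).reverse.unique
    (isLongest_gt_length_insertionTableau w.reverse)

end PlancherelHecke

/-- For a Young diagram `lam`, `lam.rowLen 0` is the length `λ₁` of its first row (`0` for the empty
diagram), and `lam.transpose` is the conjugate diagram `λ'`. -/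
theorem corollary4p5 (n q : ℕ) (w : List ℕ) (hw : w ∈ PlancherelHecke.W n q)
    (lam mu : YoungDiagram) (hlam : lam = PlancherelHecke.heckeshape w)
    (hmu : mu = PlancherelHecke.heckeshape w.reverse) :
    lam.rowLen 0 = mu.transpose.rowLen 0 ∧ mu.rowLen 0 = lam.transpose.rowLen 0 := by
  subst hlam hmu
  rw [YoungDiagram.rowLen_transpose, YoungDiagram.rowLen_transpose]
  refine ⟨PlancherelHecke.rowLen_zero_heckeshape_eq_colLen_zero_reverse w, ?_⟩
  simpa using PlancherelHecke.rowLen_zero_heckeshape_eq_colLen_zero_reverse w.reverse
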